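/- **Setting.** A network has $m$ links and $n$ users. Its routing matrix $C\in\{0,1\}^{m\times n}$ has nonzero columns $C_1,\dots,C_n$, its capacity vector $b\in\mathbb R^m$ has strictly positive components, and user $k$ has a concave utility $u_k:\mathbb R_+\to\mathbb R$. Put $U(x)=\sum_{k=1}^n u_k(x_k)$. Let $x^*$ be a solution of the primal problem $$\max\{U(x): x\in\mathbb R^n_+,\ Cx\le b\},$$ and let $\lambda^*$ be a solution of the dual problem $\min_{\lambda\in\mathbb R^m_+}\varphi(\lambda)$, where $\varphi(\lambda)=\max_{x\in\mathbb R^n_+}\{U(x)+\langle\lambda,b-Cx\rangle\}$, with $\|\lambda^*\|_2\le R$, $R>0$. For every $\lambda\in\mathbb R^m_+$ let $x_k(\lambda)\in\arg\max_{y\ge 0}\{u_k(y)-y\langle\lambda,C_k\rangle\}$ (assumed to exist; any fixed choice of maximizers), $x(\lambda)=(x_1(\lambda),\dots,x_n(\lambda))$, and for $i\in\{1,\dots,n\}$ put $$\nabla\varphi(\lambda)=b-Cx(\lambda),\qquad \nabla\varphi(\lambda,i)=b-n\,x_i(\lambda)C_i,\qquad x(\lambda,i)=(0,\dots,n\,x_i(\lambda),\dots,0)^T,$$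 the nonzero entry of the last vector being in position $i$. Let $\xi^0,\xi^1,\dots$ be independent random variables uniformly distributed on $\{1,\dots,n\}$. **Assumptions.** There are constants $M,\sigma,\sigma_x>0$ and $M_U$ such that $|U(x)-U(y)|\le M_U\|x-y\|_2$ for all $x,y\in\mathbb R^n_+$, and for all $\lambda\in\mathbb R^m_+$, $i\in\{1,\dots,n\}$ and $t\ge 0$ $$\|\nabla\varphi(\lambda,i)\|_2\le M,\qquad \mathbb E\exp\!\Big(\tfrac{\|\nabla\varphi(\lambda,\xi^t)-\nabla\varphi(\lambda)\|_2^2}{\sigma^2}\Big)\le e,\qquad \mathbb E\exp\!\Big(\tfrac{\|x(\lambda,\xi^t)-x(\lambda)\|_2^2}{\sigma_x^2}\Big)\le e .$$ **Method.** $\lambda^0=0$, $\ \lambda^{t+1}=[\lambda^t-\beta\nabla\varphi(\lambda^t,\xi^t)]_+$ (componentwise positive part) with $\beta=\frac{R}{M\sqrt N}$, and the output is $\tilde x^N=\frac1N\sum_{t=0}^{N-1}x(\lambda^t,\xi^t)$. **Theorem 2.** There is an absolute constant $K>0$ such that the following holds for all data as above, all $\varepsilon>0$ and all $\delta\in(0,1)$.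 Let $$A=\sqrt2\Big(1+\sqrt{3\ln\tfrac1\delta}\Big)\Big(M_U\sigma_x+2R\big(\sigma+\sigma_x\sqrt{\lambda_{\max}(C^TC)}\big)\Big)+2.5\,RM .$$ If the number of iterations $N$ satisfies $$N\ \ge\ K\left\lceil\frac{A^2}{\varepsilon^2}\max\Big\{1,\ln\frac{MR}{\varepsilon\delta}\Big\}\right\rceil ,$$ then with probability at least $1-4\delta$ both $$U(x^*)-U(\tilde x^N)\le\varepsilon\qquad\text{and}\qquad\big\|(C\tilde x^N-b)_+\big\|_2\le\frac{\varepsilon}{R}.$$ -/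

import Mathlib

open MeasureTheory ProbabilityTheory

noncomputable section

namespace NetworkUtility

/-- `ℝ^d` with the Euclidean norm. -/
abbrev Vec (d : ℕ) : Type := EuclideanSpace ℝ (Fin d)

/-- The nonnegative orthant `ℝ^d_+`. -/
def orthant (d : ℕ) : Set (Vec d) := {v | ∀ i, 0 ≤ v i}

/-- The componentwise positive part `[v]_+`, i.e. the Euclidean projection onto the orthant. -/
def plusPart {d : ℕ} (v : Vec d) : Vec d := WithLp.toLp 2 fun i => max (v i) 0

/-- A network with `m` links and `n` users: a Boolean routing matrix with nonzero columns,
strictly positive link capacities, and concave utilities `u k : ℝ_+ → ℝ` (the values of `u k`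
at negative arguments are never used). -/
structure Network (m n : ℕ) where
  C : Matrix (Fin m) (Fin n) ℝ
  C_bool : ∀ j k, C j k = 0 ∨ C j k = 1
  C_col_ne_zero : ∀ k, ∃ j, C j k ≠ 0
  b : Vec m
  b_pos : ∀ j, 0 < b j
  u : Fin n → ℝ → ℝ
  u_concave : ∀ k, ConcaveOn ℝ (Set.Ici 0) (u k)

namespace Network

variable {m n : ℕ} (S : Network m n)

/-- The `k`-th column `C_k` of the routing matrix. -/
def col (k : Fin n) : Vec m := WithLp.toLp 2 fun j => S.C j k

/-- The traffic `C x = ∑ₖ xₖ C_k`. -/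
def load (x : Vec n) : Vec m := ∑ k, x k • S.col k

/-- The total utility `U(x) = ∑ₖ uₖ(xₖ)`. -/
def utility (x : Vec n) : ℝ := ∑ k, S.u k (x k)

/-- `x` solves the primal problem: maximize `U(x)` over `x ≥ 0` with `C x ≤ b`. -/
def IsPrimalSolution (x : Vec n) : Prop :=
  (x ∈ orthant n ∧ ∀ j, S.load x j ≤ S.b j) ∧
    ∀ y ∈ orthant n, (∀ j, S.load y j ≤ S.b j) → S.utility y ≤ S.utility x

/-- The dual function `φ(l) = max_{x ≥ 0} (U(x) + ⟨l, b - C x⟩)`. -/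
def dual (l : Vec m) : ℝ :=
  sSup ((fun x : Vec n => S.utility x + inner ℝ l (S.b - S.load x)) '' orthant n)

/-- `l` solves the dual problem: minimize `φ(l)` over `l ≥ 0`. -/
def IsDualSolution (l : Vec m) : Prop := l ∈ orthant m ∧ IsMinOn S.dual (orthant m) l

/-- `x` selects, for all prices `l ≥ 0` and all users `k`, an optimal response
`x l k ∈ argmax_{y ≥ 0} (uₖ(y) - y ⟨l, C_k⟩)`. -/
def IsResponse (x : Vec m → Vec n) : Prop :=
  ∀ l ∈ orthant m, ∀ k, 0 ≤ x l k ∧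
    ∀ y : ℝ, 0 ≤ y → S.u k y - y * inner ℝ l (S.col k)
      ≤ S.u k (x l k) - x l k * inner ℝ l (S.col k)

/-- The subgradient `∇φ(l) = b - C x(l)`. -/
def subgrad (x : Vec m → Vec n) (l : Vec m) : Vec m := S.b - S.load (x l)

/-- The stochastic subgradient `∇φ(l, i) = b - n xᵢ(l) Cᵢ`. -/
def stochSubgrad (x : Vec m → Vec n) (l : Vec m) (i : Fin n) : Vec m :=
  S.b - ((n : ℝ) * x l i) • S.col i

/-- The prices `λ^t` of the stochastic projected subgradient method with step `β`, when the users
drawn are `s 0, s 1, …`: `λ^0 = 0` and `λ^{t+1} = [λ^t - β ∇φ(λ^t, s t)]_+`. -/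
def price (x : Vec m → Vec n) (β : ℝ) (s : ℕ → Fin n) : ℕ → Vec m
  | 0 => 0
  | t + 1 => plusPart (price x β s t - β • S.stochSubgrad x (price x β s t) (s t))

end Network

variable {m n : ℕ}

/-- The one-user estimate `x(l, i) = (0, …, n xᵢ(l), …, 0)` of `x(l)`. -/
def stochResponse (x : Vec m → Vec n) (l : Vec m) (i : Fin n) : Vec n :=
  EuclideanSpace.single i ((n : ℝ) * x l i)

/-- The primal output `x̃^N = (1/N) ∑_{t < N} x(λ^t, s t)` of the method. -/
def Network.primalOutput (S : Network m n) (x : Vec m → Vec n) (β : ℝ) (s : ℕ → Fin n)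
    (N : ℕ) : Vec n :=
  (1 / (N : ℝ)) • ∑ t ∈ Finset.range N, stochResponse x (S.price x β s t) (s t)

/-- The largest eigenvalue of `Cᵀ C`. -/
def lambdaMax (C : Matrix (Fin m) (Fin n) ℝ) : ℝ :=
  sSup {μ : ℝ | Module.End.HasEigenvalue (Matrix.toLin' (C.transpose * C)) μ}

/-- The constant `A` of the complexity bound. -/
def complexityConst (δ MU σx R σ M lmax : ℝ) : ℝ :=
  √2 * (1 + √(3 * Real.log (1 / δ))) * (MU * σx + 2 * R * (σ + σx * √lmax)) + 2.5 * R * M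

end NetworkUtility

end

open NetworkUtility

namespace NetworkUtility

/-! ### Exponential moments of finite weighted averages -/

/-! The proof has a pathwise half and a probabilistic half. Pathwise, the regret bound of projected
subgradient descent holds against every comparator in the orthant. Taking the comparator of norm at
most `2R` aligned with the constraint violation of the output makes the regret produce `2R‖(Cy -
b)₊‖`, while `⟨∇φ(λ), λ⟩ = φ(λ) - U(x(λ))`, concavity and the Lipschitz bound produce the
primal-dual gap (`IsResponse.gap_le`). Since `‖λ*‖ ≤ R`, weak duality alone turns a bound on gap
plus violation into both claims (`IsResponse.utility_sub_le_and_norm_le`).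

Two noise terms remain. The norm of the summed response errors is handled by a dimension-free vector
martingale bound (`measureReal_norm_sq_sum_gt_le`). The sum of `⟨noise, λ^t⟩` is harder because the
prices have no bound fixed in advance; an exponential supermartingale containing `‖λ^t - λ*‖²` with
a decreasing weight controls noise and prices together (`measureReal_sum_inner_noise_gt_le`). That
bound is linear in `ln(1/δ)`, whereas `A` contains only its square root; the logarithmic factor in
the iteration count pays the difference (`noise_term_le`). Each bad event has probability at most
`δ`. -/

theorem exp_le_add_exp_sq (x : ℝ) : Real.exp x ≤ x + Real.exp (x ^ 2) := by
  rcases le_total |x| 1 with h | h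
  · have h1 := (abs_le.mp (Real.abs_exp_sub_one_sub_id_le h)).2
    have h2 := Real.add_one_le_exp (x ^ 2)
    linarith
  · rcases le_abs.mp h with h | h
    · have : Real.exp x ≤ Real.exp (x ^ 2) := Real.exp_le_exp.mpr (by nlinarith)
      linarith
    · have h1 : Real.exp x ≤ 1 := Real.exp_le_one_iff.mpr (by linarith)
      have h2 := Real.add_one_le_exp (x ^ 2)
      nlinarith

section Weighted

variable {ι : Type*} [Fintype ι] {w : ι → ℝ}

/-- Jensen for the concave power `a`, done pointwise: convexity of `exp` is used on the segment from
`0` to `f i - 1`. -/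
theorem sum_weight_exp_mul_le (hw : ∀ i, 0 ≤ w i) (hw1 : ∑ i, w i = 1) {f : ι → ℝ}
    (hf : ∑ i, w i * Real.exp (f i) ≤ Real.exp 1) {a : ℝ} (ha : 0 ≤ a) (ha1 : a ≤ 1) :
    ∑ i, w i * Real.exp (a * f i) ≤ Real.exp a := by
  have key : ∀ i, Real.exp (a * f i) ≤
      Real.exp a * (a * (Real.exp (f i) / Real.exp 1) + (1 - a)) := by
    intro i
    have hc := convexOn_exp.2 (Set.mem_univ (f i - 1)) (Set.mem_univ 0) ha
      (sub_nonneg.mpr ha1) (by ring)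
    simp only [smul_eq_mul, mul_zero, add_zero, Real.exp_zero, mul_one, Real.exp_sub] at hc
    calc Real.exp (a * f i) = Real.exp a * Real.exp (a * (f i - 1)) := by
          rw [← Real.exp_add]; ring_nf
      _ ≤ _ := by gcongr
  calc ∑ i, w i * Real.exp (a * f i)
      ≤ ∑ i, w i * (Real.exp a * (a * (Real.exp (f i) / Real.exp 1) + (1 - a))) :=
        Finset.sum_le_sum fun i _ => mul_le_mul_of_nonneg_left (key i) (hw i)
    _ = Real.exp a * (a * ((∑ i, w i * Real.exp (f i)) / Real.exp 1)
          + (1 - a) * ∑ i, w i) := by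
        rw [Finset.sum_div, Finset.mul_sum, Finset.mul_sum, ← Finset.sum_add_distrib,
          Finset.mul_sum]
        exact Finset.sum_congr rfl fun i _ => by ring
    _ ≤ Real.exp a * (a * 1 + (1 - a) * 1) := by
        rw [hw1]
        have : (∑ i, w i * Real.exp (f i)) / Real.exp 1 ≤ 1 :=
          (div_le_one (Real.exp_pos 1)).mpr hf
        gcongr
    _ = Real.exp a := by ring

variable {E : Type*} [NormedAddCommGroup E] [InnerProductSpace ℝ E] {d : ι → E} {s : ℝ}

/-- A centered vector with light tails is sub-Gaussian. -/
theorem sum_weight_exp_inner_le (hw : ∀ i, 0 ≤ w i) (hw1 : ∑ i, w i = 1)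
    (hd : ∑ i, w i • d i = 0) (hs : 0 < s)
    (ht : ∑ i, w i * Real.exp (‖d i‖ ^ 2 / s ^ 2) ≤ Real.exp 1) (v : E) :
    ∑ i, w i * Real.exp (inner ℝ (d i) v) ≤ Real.exp (s ^ 2 * ‖v‖ ^ 2) := by
  have hmean : ∑ i, w i * inner ℝ (d i) v = 0 := by
    have : inner ℝ (∑ i, w i • d i) v = 0 := by rw [hd, inner_zero_left]
    simpa [sum_inner, real_inner_smul_left] using this
  -- For small `v`, `exp y ≤ y + exp (y²)` and centering removes the linear term. For large `v`,
  -- Young's inequality suffices without centering, and the leftover `exp (1/2)` is absorbed because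
  -- `s²‖v‖² ≥ 1`.
  rcases le_total (s ^ 2 * ‖v‖ ^ 2) 1 with h | h
  · have h1 : ∀ i, Real.exp (inner ℝ (d i) v) ≤
        inner ℝ (d i) v + Real.exp (s ^ 2 * ‖v‖ ^ 2 * (‖d i‖ ^ 2 / s ^ 2)) := by
      intro i
      refine (exp_le_add_exp_sq _).trans ?_
      gcongr
      have := sq_le_sq' (neg_le_of_abs_le (abs_real_inner_le_norm (d i) v))
        (le_of_abs_le (abs_real_inner_le_norm (d i) v))
      calc _ ≤ _ := this
        _ = _ := by field_simp
    calc ∑ i, w i * Real.exp (inner ℝ (d i) v)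
        ≤ ∑ i, w i * (inner ℝ (d i) v
            + Real.exp (s ^ 2 * ‖v‖ ^ 2 * (‖d i‖ ^ 2 / s ^ 2))) :=
          Finset.sum_le_sum fun i _ => mul_le_mul_of_nonneg_left (h1 i) (hw i)
      _ = ∑ i, w i * Real.exp (s ^ 2 * ‖v‖ ^ 2 * (‖d i‖ ^ 2 / s ^ 2)) := by
          simp only [mul_add, Finset.sum_add_distrib, hmean, zero_add]
      _ ≤ _ := sum_weight_exp_mul_le hw hw1 ht (by positivity) h
  · have h1 : ∀ i, Real.exp (inner ℝ (d i) v) ≤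
        Real.exp (s ^ 2 * ‖v‖ ^ 2 / 2) * Real.exp (1 / 2 * (‖d i‖ ^ 2 / s ^ 2)) := by
      intro i
      rw [← Real.exp_add]
      gcongr
      have h2 := le_of_abs_le (abs_real_inner_le_norm (d i) v)
      have h3 : ‖d i‖ * ‖v‖ = (‖d i‖ / s) * (s * ‖v‖) := by field_simp
      have h4 := two_mul_le_add_sq (‖d i‖ / s) (s * ‖v‖)
      have h5 : (‖d i‖ / s) ^ 2 = ‖d i‖ ^ 2 / s ^ 2 := div_pow _ _ _
      nlinarith
    calc ∑ i, w i * Real.exp (inner ℝ (d i) v)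
        ≤ ∑ i, w i * (Real.exp (s ^ 2 * ‖v‖ ^ 2 / 2)
            * Real.exp (1 / 2 * (‖d i‖ ^ 2 / s ^ 2))) :=
          Finset.sum_le_sum fun i _ => mul_le_mul_of_nonneg_left (h1 i) (hw i)
      _ = Real.exp (s ^ 2 * ‖v‖ ^ 2 / 2)
            * ∑ i, w i * Real.exp (1 / 2 * (‖d i‖ ^ 2 / s ^ 2)) := by
          rw [Finset.mul_sum]
          exact Finset.sum_congr rfl fun i _ => by ring
      _ ≤ Real.exp (s ^ 2 * ‖v‖ ^ 2 / 2) * Real.exp (1 / 2) := by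
          gcongr
          exact sum_weight_exp_mul_le hw hw1 ht (by norm_num) (by norm_num)
      _ ≤ _ := by
          rw [← Real.exp_add]
          gcongr
          linarith

/-- Cauchy–Schwarz separates the linear and quadratic exponents. Doubling `v` costs a factor 4, of
which the square root leaves 2; `hθ1` keeps the doubled quadratic exponent within reach of
`sum_weight_exp_mul_le`. -/
theorem sum_weight_exp_inner_add_sq_le (hw : ∀ i, 0 ≤ w i) (hw1 : ∑ i, w i = 1)
    (hd : ∑ i, w i • d i = 0) (hs : 0 < s)
    (ht : ∑ i, w i * Real.exp (‖d i‖ ^ 2 / s ^ 2) ≤ Real.exp 1) (v : E)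
    {θ : ℝ} (hθ : 0 ≤ θ) (hθ1 : 2 * (s ^ 2 * θ) ≤ 1) :
    ∑ i, w i * Real.exp (inner ℝ (d i) v + θ * ‖d i‖ ^ 2) ≤
      Real.exp (2 * (s ^ 2 * ‖v‖ ^ 2) + s ^ 2 * θ) := by
  have h1 := sum_weight_exp_inner_le hw hw1 hd hs ht ((2 : ℝ) • v)
  have h2 := sum_weight_exp_mul_le hw hw1 ht (a := 2 * (s ^ 2 * θ)) (by positivity) hθ1
  set a := Real.exp (2 * (s ^ 2 * ‖v‖ ^ 2)) with ha
  set c := Real.exp (s ^ 2 * θ) with hc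
  have ha0 : 0 < a := Real.exp_pos _
  have hc0 : 0 < c := Real.exp_pos _
  have h1' : ∑ i, w i * (Real.exp (inner ℝ (d i) v)) ^ 2 ≤ a ^ 2 := by
    convert h1 using 1
    · refine Finset.sum_congr rfl fun i _ => ?_
      rw [real_inner_smul_right, ← Real.exp_nat_mul]
      norm_num
    · rw [ha, ← Real.exp_nat_mul, norm_smul]
      norm_num
      ring
  have h2' : ∑ i, w i * (Real.exp (θ * ‖d i‖ ^ 2)) ^ 2 ≤ c ^ 2 := by
    convert h2 using 1
    · refine Finset.sum_congr rfl fun i _ => ?_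
      rw [← Real.exp_nat_mul]
      congr 2
      push_cast
      field_simp
    · rw [hc, ← Real.exp_nat_mul]
      norm_num
  -- Pointwise AM–GM, weighted so that the bounds `a²` and `c²` average to exactly `a * c`.
  have h3 : ∀ i, Real.exp (inner ℝ (d i) v + θ * ‖d i‖ ^ 2) ≤
      c / (2 * a) * (Real.exp (inner ℝ (d i) v)) ^ 2
        + a / (2 * c) * (Real.exp (θ * ‖d i‖ ^ 2)) ^ 2 := by
    intro i
    rw [Real.exp_add]
    set p := Real.exp (inner ℝ (d i) v)
    set q := Real.exp (θ * ‖d i‖ ^ 2)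
    have : c / (2 * a) * p ^ 2 + a / (2 * c) * q ^ 2 - p * q
        = (c * p - a * q) ^ 2 / (2 * a * c) := by field_simp; ring
    have h0 : 0 ≤ (c * p - a * q) ^ 2 / (2 * a * c) := by positivity
    linarith
  rw [Real.exp_add]
  calc ∑ i, w i * Real.exp (inner ℝ (d i) v + θ * ‖d i‖ ^ 2)
      ≤ ∑ i, w i * (c / (2 * a) * (Real.exp (inner ℝ (d i) v)) ^ 2
        + a / (2 * c) * (Real.exp (θ * ‖d i‖ ^ 2)) ^ 2) :=
        Finset.sum_le_sum fun i _ => mul_le_mul_of_nonneg_left (h3 i) (hw i)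
    _ = c / (2 * a) * ∑ i, w i * (Real.exp (inner ℝ (d i) v)) ^ 2
        + a / (2 * c) * ∑ i, w i * (Real.exp (θ * ‖d i‖ ^ 2)) ^ 2 := by
        rw [Finset.mul_sum, Finset.mul_sum, ← Finset.sum_add_distrib]
        exact Finset.sum_congr rfl fun i _ => by ring
    _ ≤ c / (2 * a) * a ^ 2 + a / (2 * c) * c ^ 2 := by gcongr
    _ = a * c := by field_simp; ring

end Weighted

/-! ### Independent uniform draws -/

section Draws

variable {n : ℕ} {Ω : Type*} [MeasurableSpace Ω] {P : Measure Ω} [IsProbabilityMeasure P]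
  {ξ : ℕ → Ω → Fin n}

theorem integrable_of_finite_range {α : Type*} [Finite α] [MeasurableSpace α]
    [MeasurableSingletonClass α] {X : Ω → α} (hX : Measurable X) (f : α → ℝ) :
    Integrable (fun ω => f (X ω)) P := by
  have : Fintype α := Fintype.ofFinite α
  refine Integrable.of_bound ((measurable_of_finite f).comp hX).aestronglyMeasurable
    (∑ a, ‖f a‖) (Filter.Eventually.of_forall fun ω => ?_)
  exact Finset.single_le_sum (f := fun a => ‖f a‖) (fun a _ => norm_nonneg _)
    (Finset.mem_univ (X ω))

theorem integral_uniform (hm : ∀ t, Measurable (ξ t))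
    (hu : ∀ t i, P.real {ω | ξ t ω = i} = 1 / (n : ℝ)) (t : ℕ) (f : Fin n → ℝ) :
    ∫ ω, f (ξ t ω) ∂P = ∑ i, 1 / (n : ℝ) * f i := by
  rw [← integral_map (φ := ξ t) (f := f) (hm t).aemeasurable
    (measurable_of_finite f).aestronglyMeasurable]
  have : IsProbabilityMeasure (P.map (ξ t)) := Measure.isProbabilityMeasure_map (hm t).aemeasurable
  rw [integral_fintype Integrable.of_finite]
  refine Finset.sum_congr rfl fun i _ => ?_
  rw [smul_eq_mul, map_measureReal_apply (hm t) (measurableSet_singleton i)]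
  congr 1
  exact hu t i

theorem integrable_of_dependsOn (hm : ∀ t, Measurable (ξ t)) (t : ℕ)
    {F : (ℕ → Fin n) → ℝ} (hF : ∀ s s' : ℕ → Fin n, (∀ r < t, s r = s' r) → F s = F s') :
    Integrable (fun ω => F fun r => ξ r ω) P := by
  -- `ξ 0 ω₀` is a filler that extends a finite history to a full path; `F` does not see it.
  obtain ⟨ω₀⟩ := nonempty_of_isProbabilityMeasure P
  have hX : Measurable fun ω (r : Finset.range t) => ξ r ω := measurable_pi_lambda _ fun r => hm r
  have := integrable_of_finite_range (P := P) hX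
    (fun a => F fun r => if h : r ∈ Finset.range t then a ⟨r, h⟩ else ξ 0 ω₀)
  refine this.congr (Filter.Eventually.of_forall fun ω => hF _ _ fun r hr => ?_)
  simp [hr]

/-- A function of the draws up to time `t` may be averaged over the draw at time `t` first. -/
theorem integral_eq_sum_integral_update (hm : ∀ t, Measurable (ξ t)) (hi : iIndepFun ξ P)
    (hu : ∀ t i, P.real {ω | ξ t ω = i} = 1 / (n : ℝ)) (t : ℕ)
    {F : (ℕ → Fin n) → ℝ} (hF : ∀ s s' : ℕ → Fin n, (∀ r < t + 1, s r = s' r) → F s = F s') :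
    ∫ ω, F (fun r => ξ r ω) ∂P
      = ∑ i, 1 / (n : ℝ) * ∫ ω, F (Function.update (fun r => ξ r ω) t i) ∂P := by
  obtain ⟨ω₀⟩ := nonempty_of_isProbabilityMeasure P
  have hX : Measurable fun ω (r : Finset.range t) => ξ r ω := measurable_pi_lambda _ fun r => hm r
  have hind : IndepFun (fun ω (r : ({t} : Finset ℕ)) => ξ r ω)
      (fun ω (r : Finset.range t) => ξ r ω) P :=
    hi.indepFun_finset {t} (Finset.range t) (by simp) hm
  have hdep : ∀ i, ∀ s s' : ℕ → Fin n, (∀ r < t, s r = s' r) →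
      F (Function.update s t i) = F (Function.update s' t i) := by
    intro i s s' h
    refine hF _ _ fun r hr => ?_
    rcases eq_or_ne r t with rfl | hne
    · simp
    · simp [hne, h r (by omega)]
  have hint : ∀ i, Integrable (fun ω => F (Function.update (fun r => ξ r ω) t i)) P :=
    fun i => integrable_of_dependsOn hm t (F := fun s => F (Function.update s t i)) (hdep i)
  let g : Fin n → Fin n → ℝ := fun i j => if j = i then 1 else 0
  -- Split by the value of the draw at time `t`: once that draw is overwritten by `i`, the second
  -- factor depends only on earlier draws and is independent of the indicator.
  have hsplit : ∀ ω, F (fun r => ξ r ω)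
      = ∑ i, g i (ξ t ω) * F (Function.update (fun r => ξ r ω) t i) := by
    intro ω
    simp only [g, ite_mul, one_mul, zero_mul, Finset.sum_ite_eq, Finset.mem_univ, if_true]
    rw [Function.update_eq_self t (fun r => ξ r ω)]
  have hprod : ∀ i, IndepFun (fun ω => g i (ξ t ω))
      (fun ω => F (Function.update (fun r => ξ r ω) t i)) P := by
    intro i
    have h := hind.comp
      (φ := fun a => g i (a ⟨t, Finset.mem_singleton_self t⟩))
      (ψ := fun a => F (Function.update
        (fun r => if h : r ∈ Finset.range t then a ⟨r, h⟩ else ξ 0 ω₀) t i))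
      (measurable_of_finite _) (measurable_of_finite _)
    refine h.congr (Filter.Eventually.of_forall fun ω => rfl)
      (Filter.Eventually.of_forall fun ω => hdep i _ _ fun r hr => ?_)
    simp [hr]
  have hgint : ∀ i, Integrable (fun ω => g i (ξ t ω)) P :=
    fun i => integrable_of_finite_range (hm t) (g i)
  have hg : ∀ i, ∫ ω, g i (ξ t ω) ∂P = 1 / (n : ℝ) := by
    intro i
    rw [integral_uniform hm hu]
    simp [g]
  simp_rw [hsplit]
  have hmul : ∀ i, Integrable
      (fun ω => g i (ξ t ω) * F (Function.update (fun r => ξ r ω) t i)) P :=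
    fun i => (hprod i).integrable_mul (hgint i) (hint i)
  rw [integral_finsetSum _ fun i _ => hmul i]
  refine Finset.sum_congr rfl fun i _ => ?_
  rw [(hprod i).integral_fun_mul_eq_mul_integral (hgint i).aestronglyMeasurable
    (hint i).aestronglyMeasurable, hg i]

/-- Conditional expectation given the past is here the finite average over `Function.update s t i`,
so the supermartingale property is a pathwise inequality and no filtration is needed. -/
theorem integral_supermartingale_le (hm : ∀ t, Measurable (ξ t)) (hi : iIndepFun ξ P)
    (hu : ∀ t i, P.real {ω | ξ t ω = i} = 1 / (n : ℝ)) {N : ℕ}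
    {W : ℕ → (ℕ → Fin n) → ℝ}
    (hW : ∀ t, ∀ s s' : ℕ → Fin n, (∀ r < t, s r = s' r) → W t s = W t s')
    (hstep : ∀ t < N, ∀ s : ℕ → Fin n,
      ∑ i, 1 / (n : ℝ) * W (t + 1) (Function.update s t i) ≤ W t s) {w₀ : ℝ}
    (h0 : ∀ s, W 0 s ≤ w₀) : ∫ ω, W N (fun r => ξ r ω) ∂P ≤ w₀ := by
  have hint : ∀ t i, Integrable (fun ω => W (t + 1) (Function.update (fun r => ξ r ω) t i)) P := by
    intro t i
    refine integrable_of_dependsOn hm t (F := fun s => W (t + 1) (Function.update s t i))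
      fun s s' h => hW _ _ _ fun r hr => ?_
    rcases eq_or_ne r t with rfl | hne
    · simp
    · simp [hne, h r (by omega)]
  have hmain : ∀ t ≤ N, ∫ ω, W t (fun r => ξ r ω) ∂P ≤ w₀ := by
    intro t
    induction t with
    | zero =>
      intro _
      calc ∫ ω, W 0 (fun r => ξ r ω) ∂P ≤ ∫ _, w₀ ∂P :=
            integral_mono (integrable_of_dependsOn hm 0 (hW 0)) (integrable_const _)
              fun ω => h0 _
        _ = w₀ := by simp
    | succ t ih =>
      intro ht
      rw [integral_eq_sum_integral_update hm hi hu t (hW (t + 1))]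
      simp_rw [← integral_const_mul]
      rw [← integral_finsetSum _ fun i _ => (hint t i).const_mul _]
      refine le_trans (integral_mono (integrable_finsetSum _ fun i _ => (hint t i).const_mul _)
        (integrable_of_dependsOn hm t (hW t)) fun ω => ?_) (ih (by omega))
      exact hstep t (by omega) _
  exact hmain N le_rfl

/-- Markov's inequality for an exponential supermartingale that starts below `exp c`. -/
theorem measureReal_supermartingale_gt_le (hm : ∀ t, Measurable (ξ t)) (hi : iIndepFun ξ P)
    (hu : ∀ t i, P.real {ω | ξ t ω = i} = 1 / (n : ℝ)) {N : ℕ}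
    {Y : ℕ → (ℕ → Fin n) → ℝ}
    (hY : ∀ t, ∀ s s' : ℕ → Fin n, (∀ r < t, s r = s' r) → Y t s = Y t s')
    (hstep : ∀ t < N, ∀ s : ℕ → Fin n,
      ∑ i, 1 / (n : ℝ) * Real.exp (Y (t + 1) (Function.update s t i)) ≤ Real.exp (Y t s)) {c : ℝ}
    (h0 : ∀ s, Y 0 s ≤ c) {δ : ℝ} (hδ : 0 < δ) :
    P.real {ω | c + Real.log (1 / δ) < Y N (fun r => ξ r ω)} ≤ δ := by
  have hW : ∀ t, ∀ s s' : ℕ → Fin n, (∀ r < t, s r = s' r) →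
      Real.exp (Y t s) = Real.exp (Y t s') := fun t s s' h => by rw [hY t s s' h]
  have hE := integral_supermartingale_le hm hi hu (W := fun t s => Real.exp (Y t s)) hW hstep
    (w₀ := Real.exp c) fun s => Real.exp_le_exp.mpr (h0 s)
  have hM := mul_meas_ge_le_integral_of_nonneg (μ := P)
    (f := fun ω => Real.exp (Y N (fun r => ξ r ω)))
    (Filter.Eventually.of_forall fun ω => (Real.exp_pos _).le)
    (integrable_of_dependsOn hm N (F := fun s => Real.exp (Y N s)) (hW N))
    (Real.exp c * (1 / δ))
  have hsub : P.real {ω | c + Real.log (1 / δ) < Y N (fun r => ξ r ω)} ≤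
      P.real {ω | Real.exp c * (1 / δ) ≤ Real.exp (Y N (fun r => ξ r ω))} := by
    refine measureReal_mono fun ω hω => ?_
    have h1 : Real.exp (c + Real.log (1 / δ)) ≤ Real.exp (Y N (fun r => ξ r ω)) :=
      Real.exp_le_exp.mpr (le_of_lt hω)
    rwa [Real.exp_add, Real.exp_log (by positivity)] at h1
  have h2 := hM.trans hE
  have h3 : Real.exp c * (1 / δ * P.real
      {ω | Real.exp c * (1 / δ) ≤ Real.exp (Y N (fun r => ξ r ω))}) ≤ Real.exp c * 1 := by
    rw [← mul_assoc, mul_one]; exact h2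
  have h4 := le_of_mul_le_mul_left h3 (Real.exp_pos c)
  rw [one_div_mul_eq_div, div_le_one hδ] at h4
  exact hsub.trans h4

end Draws

/-! ### Concentration of vector-valued martingale sums -/

section VectorConcentration

variable {n : ℕ} {Ω : Type*} [MeasurableSpace Ω] {P : Measure Ω} [IsProbabilityMeasure P]
  {ξ : ℕ → Ω → Fin n}

/-- `d t s i` is the increment at time `t` after history `s` when the draw is `i`; redrawing at time
`t` leaves the earlier increments alone. -/
theorem sum_range_update {M : Type*} [AddCommMonoid M] {d : ℕ → (ℕ → Fin n) → Fin n → M}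
    (hdep : ∀ t, ∀ s s' : ℕ → Fin n, (∀ r < t, s r = s' r) → d t s = d t s')
    (t : ℕ) (s : ℕ → Fin n) (i : Fin n) :
    ∑ r ∈ Finset.range (t + 1), d r (Function.update s t i) (Function.update s t i r)
      = (∑ r ∈ Finset.range t, d r s (s r)) + d t s i := by
  rw [Finset.sum_range_succ]
  congr 1
  · refine Finset.sum_congr rfl fun r hr => ?_
    have hr' := Finset.mem_range.mp hr
    rw [Function.update_of_ne (by omega)]
    exact congrFun (hdep r _ _ fun q hq =>
      Function.update_of_ne (show q ≠ t by omega) _ _) _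
  · rw [Function.update_self]
    exact congrFun (hdep t _ _ fun q hq =>
      Function.update_of_ne (show q ≠ t by omega) _ _) _

theorem sum_range_congr_of_dependsOn {M : Type*} [AddCommMonoid M]
    {d : ℕ → (ℕ → Fin n) → Fin n → M}
    (hdep : ∀ t, ∀ s s' : ℕ → Fin n, (∀ r < t, s r = s' r) → d t s = d t s')
    {t : ℕ} {s s' : ℕ → Fin n} (h : ∀ r < t, s r = s' r) :
    ∑ r ∈ Finset.range t, d r s (s r) = ∑ r ∈ Finset.range t, d r s' (s' r) := by
  refine Finset.sum_congr rfl fun r hr => ?_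
  have hr' := Finset.mem_range.mp hr
  rw [hdep r s s' fun q hq => h q (hq.trans hr'), h r hr']

/-- Dimension-free concentration for vector martingales with light tails. -/
theorem measureReal_norm_sq_sum_gt_le {E : Type*} [NormedAddCommGroup E] [InnerProductSpace ℝ E]
    (hn : 0 < n) (hm : ∀ t, Measurable (ξ t)) (hi : iIndepFun ξ P)
    (hu : ∀ t i, P.real {ω | ξ t ω = i} = 1 / (n : ℝ)) {N : ℕ} (hN : 0 < N)
    {d : ℕ → (ℕ → Fin n) → Fin n → E} {σ : ℝ} (hσ : 0 < σ)
    (hdep : ∀ t, ∀ s s' : ℕ → Fin n, (∀ r < t, s r = s' r) → d t s = d t s')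
    (hd : ∀ t s, ∑ i, (1 / (n : ℝ)) • d t s i = 0)
    (ht : ∀ t s, ∑ i, 1 / (n : ℝ) * Real.exp (‖d t s i‖ ^ 2 / σ ^ 2) ≤ Real.exp 1)
    {δ : ℝ} (hδ : 0 < δ) :
    P.real {ω | σ ^ 2 * N * (2 + 32 * Real.log (1 / δ)) <
      ‖∑ t ∈ Finset.range N, d t (fun r => ξ r ω) (ξ t ω)‖ ^ 2} ≤ δ := by
  have hn' : (0 : ℝ) < n := by exact_mod_cast hn
  have hN' : (0 : ℝ) < N := by exact_mod_cast hN
  have hN1 : (1 : ℝ) ≤ N := by exact_mod_cast hN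
  set a : ℝ := 1 / (32 * σ ^ 2 * N) with ha
  have ha0 : 0 < a := by positivity
  have haσ : σ ^ 2 * a * N = 1 / 32 := by rw [ha]; field_simp
  -- The weight of `‖S_t‖²` falls from `2a` to `a`. Its drop `a/N` per step absorbs the term
  -- `8σ²θ²‖S_t‖²` of the moment bound, and `t/(16N)` pays for `σ²θ ≤ 1/(16N)`. At time `N` the
  -- threshold is `(1/16 + ln(1/δ)) / a`.
  have key := measureReal_supermartingale_gt_le hm hi hu (N := N)
    (Y := fun t s => a * (2 - t / N) * ‖∑ r ∈ Finset.range t, d r s (s r)‖ ^ 2 - t / (16 * N))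
    (fun t s s' h => by rw [sum_range_congr_of_dependsOn hdep h]) ?_ (c := 0) (fun s => by simp) hδ
  · refine le_trans (measureReal_mono fun ω hω => ?_) key
    simp only [Set.mem_ofPred_eq] at hω ⊢
    set S := ‖∑ t ∈ Finset.range N, d t (fun r => ξ r ω) (ξ t ω)‖ ^ 2
    have h1 : a * (σ ^ 2 * N * (2 + 32 * Real.log (1 / δ))) < a * S :=
      mul_lt_mul_of_pos_left hω ha0
    have h2 : a * (σ ^ 2 * N * (2 + 32 * Real.log (1 / δ)))
        = (σ ^ 2 * a * N) * (2 + 32 * Real.log (1 / δ)) := by ring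
    have h3 : (N : ℝ) / N = 1 := div_self hN'.ne'
    have h4 : (N : ℝ) / (16 * N) = 1 / 16 := by field_simp
    rw [h2, haσ] at h1
    rw [h3, h4]
    linarith
  · intro t htN s
    have htN' : (t : ℝ) + 1 ≤ N := by exact_mod_cast htN
    set S := ∑ r ∈ Finset.range t, d r s (s r) with hS
    set θ : ℝ := a * (2 - (t + 1 : ℕ) / N) with hθ
    have hfrac : ((t + 1 : ℕ) : ℝ) / N ≤ 1 := by
      rw [div_le_one hN']; exact_mod_cast htN
    have hfrac0 : 0 ≤ ((t + 1 : ℕ) : ℝ) / N := by positivity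
    have hθ0 : 0 ≤ θ := mul_nonneg ha0.le (by linarith)
    have hθa : θ ≤ 2 * a := by
      rw [hθ]; nlinarith
    have hσθ : σ ^ 2 * θ ≤ 1 / (16 * N) := by
      rw [le_div_iff₀ (by positivity)]
      have := mul_le_mul_of_nonneg_left hθa (by positivity : 0 ≤ σ ^ 2 * N)
      nlinarith
    have h16 : 1 / (16 * (N : ℝ)) ≤ 1 / 16 :=
      one_div_le_one_div_of_le (by norm_num) (by linarith)
    have hmgf := sum_weight_exp_inner_add_sq_le (w := fun _ : Fin n => 1 / (n : ℝ))
      (fun _ => by positivity) (by simp [hn'.ne']) (hd t s) hσ (ht t s)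
      ((2 * θ) • S) hθ0 (by linarith)
    have hexp : ∀ i, θ * ‖∑ r ∈ Finset.range (t + 1),
          d r (Function.update s t i) (Function.update s t i r)‖ ^ 2
          - (t + 1 : ℕ) / (16 * N)
        = (θ * ‖S‖ ^ 2 - (t + 1 : ℕ) / (16 * N))
          + (inner ℝ (d t s i) ((2 * θ) • S) + θ * ‖d t s i‖ ^ 2) := by
      intro i
      rw [sum_range_update hdep, ← hS, norm_add_sq_real, real_inner_smul_right,
        real_inner_comm]
      ring
    simp only [hexp, Real.exp_add (θ * ‖S‖ ^ 2 - (t + 1 : ℕ) / (16 * N))]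
    simp only [mul_left_comm (1 / (n : ℝ)) (Real.exp (θ * ‖S‖ ^ 2 - (t + 1 : ℕ) / (16 * N)))]
    rw [← Finset.mul_sum]
    refine (mul_le_mul_of_nonneg_left hmgf (Real.exp_pos _).le).trans ?_
    rw [← Real.exp_add, Real.exp_le_exp, norm_smul, Real.norm_of_nonneg (by positivity)]
    have hstep : a * (2 - t / N) = θ + a / N := by
      rw [hθ]; push_cast; field_simp; ring
    have hquad : 8 * (σ ^ 2 * θ) * θ ≤ a / N := by
      calc 8 * (σ ^ 2 * θ) * θ ≤ 8 * (1 / (16 * N)) * (2 * a) := by gcongr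
        _ = a / N := by field_simp; norm_num
    have hquad' := mul_le_mul_of_nonneg_right hquad (sq_nonneg ‖S‖)
    have hlin : ((t + 1 : ℕ) : ℝ) / (16 * N) = t / (16 * N) + 1 / (16 * N) := by
      push_cast; rw [add_div]
    rw [hstep, hlin]
    nlinarith

end VectorConcentration

/-! ### The positive part -/

section PlusPart

variable {d : ℕ}

@[simp] theorem plusPart_apply (v : Vec d) (i : Fin d) : plusPart v i = max (v i) 0 := rfl

theorem plusPart_mem_orthant (v : Vec d) : plusPart v ∈ orthant d := fun _ => le_max_right _ _

theorem inner_eq_sum_mul (v w : Vec d) : inner ℝ v w = ∑ i, v i * w i := by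
  simp [PiLp.inner_apply, mul_comm]

theorem norm_sq_plusPart_sub_le (v : Vec d) {w : Vec d} (hw : w ∈ orthant d) :
    ‖plusPart v - w‖ ^ 2 ≤ ‖v - w‖ ^ 2 := by
  rw [EuclideanSpace.real_norm_sq_eq, EuclideanSpace.real_norm_sq_eq]
  refine Finset.sum_le_sum fun i _ => ?_
  have hwi := hw i
  simp only [PiLp.sub_apply, plusPart_apply]
  rcases le_total (v i) 0 with h | h
  · rw [max_eq_right h]; nlinarith
  · rw [max_eq_left h]

theorem inner_plusPart_self (v : Vec d) : inner ℝ v (plusPart v) = ‖plusPart v‖ ^ 2 := by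
  rw [EuclideanSpace.real_norm_sq_eq, inner_eq_sum_mul]
  refine Finset.sum_congr rfl fun i _ => ?_
  rw [plusPart_apply]
  rcases le_total (v i) 0 with h | h
  · simp [max_eq_right h]
  · rw [max_eq_left h]; ring

theorem inner_le_norm_mul_norm_plusPart {w : Vec d} (hw : w ∈ orthant d) (v : Vec d) :
    inner ℝ w v ≤ ‖w‖ * ‖plusPart v‖ := by
  refine le_trans ?_ (real_inner_le_norm w (plusPart v))
  rw [inner_eq_sum_mul, inner_eq_sum_mul]
  exact Finset.sum_le_sum fun i _ => mul_le_mul_of_nonneg_left (le_max_left _ _) (hw i)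

/-- The vector of norm at most `r` in the orthant that maximizes the inner product with `v`. -/
theorem exists_mem_orthant_inner_eq (v : Vec d) {r : ℝ} (hr : 0 ≤ r) :
    ∃ w ∈ orthant d, ‖w‖ ≤ r ∧ inner ℝ v w = r * ‖plusPart v‖ := by
  rcases eq_or_ne (plusPart v) 0 with h | h
  · exact ⟨0, fun i => le_rfl, by simpa using hr, by simp [h]⟩
  · have h0 : 0 < ‖plusPart v‖ := norm_pos_iff.mpr h
    refine ⟨(r / ‖plusPart v‖) • plusPart v,
      fun i => mul_nonneg (by positivity) (plusPart_mem_orthant v i), ?_, ?_⟩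
    · rw [norm_smul, Real.norm_of_nonneg (by positivity), div_mul_cancel₀ _ h0.ne']
    · rw [real_inner_smul_right, inner_plusPart_self]
      field_simp

end PlusPart

/-! ### The dual function and its subgradients -/

namespace Network

variable {m n : ℕ} (S : Network m n) {x : Vec m → Vec n}

theorem load_add (y z : Vec n) : S.load (y + z) = S.load y + S.load z := by
  simp [load, add_smul, Finset.sum_add_distrib]

theorem load_smul (c : ℝ) (y : Vec n) : S.load (c • y) = c • S.load y := by
  simp [load, mul_smul, Finset.smul_sum]

theorem load_sum {ι : Type*} (s : Finset ι) (y : ι → Vec n) :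
    S.load (∑ i ∈ s, y i) = ∑ i ∈ s, S.load (y i) := by
  classical
  induction s using Finset.induction_on with
  | empty => simp [load]
  | insert a s ha ih => rw [Finset.sum_insert ha, load_add, ih, Finset.sum_insert ha]

/-- The Lagrangian `U(y) + ⟨l, b - C y⟩`. -/
noncomputable def lagrangian (l : Vec m) (y : Vec n) : ℝ := S.utility y + inner ℝ l (S.b - S.load y)

/-- The Lagrangian separates over users, which is why individually optimal responses maximize it
jointly. -/
theorem lagrangian_eq (l : Vec m) (y : Vec n) :
    S.lagrangian l y = inner ℝ l S.b + ∑ k, (S.u k (y k) - y k * inner ℝ l (S.col k)) := by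
  rw [lagrangian, utility, load, inner_sub_right, inner_sum, Finset.sum_sub_distrib]
  simp only [real_inner_smul_right]
  ring

variable {S}

theorem IsResponse.mem_orthant (hx : S.IsResponse x) {l : Vec m} (hl : l ∈ orthant m) :
    x l ∈ orthant n := fun k => (hx l hl k).1

theorem IsResponse.lagrangian_le (hx : S.IsResponse x) {l : Vec m} (hl : l ∈ orthant m)
    {y : Vec n} (hy : y ∈ orthant n) : S.lagrangian l y ≤ S.lagrangian l (x l) := by
  rw [lagrangian_eq, lagrangian_eq]
  exact add_le_add_right (Finset.sum_le_sum fun k _ => (hx l hl k).2 _ (hy k)) _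

/-- The response attains the supremum, so the `sSup` in `dual` is a true maximum and not a default
value. -/
theorem IsResponse.dual_eq (hx : S.IsResponse x) {l : Vec m} (hl : l ∈ orthant m) :
    S.dual l = S.lagrangian l (x l) := by
  refine IsGreatest.csSup_eq ⟨⟨x l, hx.mem_orthant hl, rfl⟩, ?_⟩
  rintro _ ⟨y, hy, rfl⟩
  exact hx.lagrangian_le hl hy

theorem IsResponse.lagrangian_le_dual (hx : S.IsResponse x) {l : Vec m} (hl : l ∈ orthant m)
    {y : Vec n} (hy : y ∈ orthant n) : S.lagrangian l y ≤ S.dual l :=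
  (hx.lagrangian_le hl hy).trans (hx.dual_eq hl).ge

theorem IsResponse.inner_subgrad_self (hx : S.IsResponse x) {l : Vec m} (hl : l ∈ orthant m) :
    inner ℝ (S.subgrad x l) l = S.dual l - S.utility (x l) := by
  rw [hx.dual_eq hl, lagrangian, subgrad, real_inner_comm]
  ring

/-- The subgradient inequality: the Lagrangian at the fixed point `x l` is affine in the price, lies
below the dual function, and touches it at `l`. -/
theorem IsResponse.dual_sub_dual_le (hx : S.IsResponse x) {l l' : Vec m} (hl : l ∈ orthant m)
    (hl' : l' ∈ orthant m) : S.dual l - S.dual l' ≤ inner ℝ (S.subgrad x l) (l - l') := by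
  have h := hx.lagrangian_le_dual hl' (hx.mem_orthant hl)
  rw [inner_sub_right, hx.inner_subgrad_self hl]
  rw [lagrangian, real_inner_comm] at h
  rw [subgrad]
  linarith

theorem IsPrimalSolution.utility_le_dual {xstar : Vec n} (hs : S.IsPrimalSolution xstar)
    (hx : S.IsResponse x) {l : Vec m} (hl : l ∈ orthant m) : S.utility xstar ≤ S.dual l := by
  refine le_trans ?_ (hx.lagrangian_le_dual hl hs.1.1)
  rw [lagrangian, inner_eq_sum_mul, le_add_iff_nonneg_right]
  exact Finset.sum_nonneg fun j _ => mul_nonneg (hl j) (sub_nonneg.mpr (hs.1.2 j))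

variable (S)

theorem concaveOn_utility : ConcaveOn ℝ (orthant n) S.utility := by
  refine ⟨fun y hy z hz a b ha hb _ k =>
    add_nonneg (mul_nonneg ha (hy k)) (mul_nonneg hb (hz k)), fun y hy z hz a b ha hb hab => ?_⟩
  simp only [utility, smul_eq_mul, Finset.mul_sum, ← Finset.sum_add_distrib]
  exact Finset.sum_le_sum fun k _ => (S.u_concave k).2 (hy k) (hz k) ha hb hab

/-! ### The price trajectory and its regret -/

theorem price_mem_orthant (x : Vec m → Vec n) (β : ℝ) (s : ℕ → Fin n) (t : ℕ) :
    S.price x β s t ∈ orthant m := by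
  cases t with
  | zero => exact fun i => le_rfl
  | succ t => exact plusPart_mem_orthant _

theorem price_congr (x : Vec m → Vec n) (β : ℝ) (t : ℕ) (s s' : ℕ → Fin n)
    (h : ∀ r < t, s r = s' r) : S.price x β s t = S.price x β s' t := by
  induction t with
  | zero => rfl
  | succ t ih =>
    simp only [price]
    rw [ih fun r hr => h r (by omega), h t (by omega)]

theorem norm_sq_price_succ_sub_le (x : Vec m → Vec n) {β M : ℝ}
    (hM : ∀ l ∈ orthant m, ∀ i, ‖S.stochSubgrad x l i‖ ≤ M) (s : ℕ → Fin n) (t : ℕ)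
    {w : Vec m} (hw : w ∈ orthant m) :
    ‖S.price x β s (t + 1) - w‖ ^ 2 ≤ ‖S.price x β s t - w‖ ^ 2
      - 2 * β * inner ℝ (S.stochSubgrad x (S.price x β s t) (s t)) (S.price x β s t - w)
      + β ^ 2 * M ^ 2 := by
  set p := S.price x β s t with hp
  set g := S.stochSubgrad x p (s t) with hg
  have h1 : ‖S.price x β s (t + 1) - w‖ ^ 2 ≤ ‖p - β • g - w‖ ^ 2 :=
    norm_sq_plusPart_sub_le _ hw
  have h2 : p - β • g - w = (p - w) - β • g := by abel
  have h3 : ‖g‖ ≤ M := hM p (S.price_mem_orthant x β s t) (s t)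
  have h4 : ‖g‖ ^ 2 ≤ M ^ 2 := by gcongr
  rw [h2, norm_sub_sq_real (p - w), real_inner_smul_right, norm_smul, mul_pow, Real.norm_eq_abs, sq_abs,
    real_inner_comm] at h1
  nlinarith [mul_le_mul_of_nonneg_left h4 (sq_nonneg β)]

/-- The regret of the stochastic projected subgradient method. -/
theorem sum_inner_stochSubgrad_le (x : Vec m → Vec n) {β M : ℝ} (hβ : 0 < β)
    (hM : ∀ l ∈ orthant m, ∀ i, ‖S.stochSubgrad x l i‖ ≤ M) (s : ℕ → Fin n) (N : ℕ)
    {w : Vec m} (hw : w ∈ orthant m) :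
    ∑ t ∈ Finset.range N,
      inner ℝ (S.stochSubgrad x (S.price x β s t) (s t)) (S.price x β s t - w)
      ≤ ‖w‖ ^ 2 / (2 * β) + N * (β * M ^ 2 / 2) := by
  have h : ∀ N : ℕ, 2 * β * ∑ t ∈ Finset.range N,
      inner ℝ (S.stochSubgrad x (S.price x β s t) (s t)) (S.price x β s t - w)
      ≤ ‖w‖ ^ 2 + N * (β ^ 2 * M ^ 2) - ‖S.price x β s N - w‖ ^ 2 := by
    intro N
    induction N with
    | zero => simp [price]
    | succ N ih =>
      have := S.norm_sq_price_succ_sub_le x (β := β) hM s N hw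
      rw [Finset.sum_range_succ, mul_add]
      push_cast
      linarith
  have h1 := h N
  have h2 := sq_nonneg ‖S.price x β s N - w‖
  have h3 : ‖w‖ ^ 2 / (2 * β) + N * (β * M ^ 2 / 2)
      = (‖w‖ ^ 2 + N * (β ^ 2 * M ^ 2)) / (2 * β) := by field_simp
  rw [h3, le_div_iff₀ (by positivity), mul_comm]
  linarith

variable {S}

theorem sum_stochResponse (hn : 0 < n) (x : Vec m → Vec n) (l : Vec m) :
    ∑ i, (1 / (n : ℝ)) • (stochResponse x l i - x l) = 0 := by
  have hn' : (n : ℝ) ≠ 0 := by exact_mod_cast hn.ne'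
  ext k
  simp [stochResponse, Finset.sum_sub_distrib, smul_sub, Pi.single_apply, hn']

theorem load_stochResponse (x : Vec m → Vec n) (l : Vec m) (i : Fin n) :
    S.load (stochResponse x l i) = ((n : ℝ) * x l i) • S.col i := by
  rw [load, Finset.sum_eq_single i]
  · simp [stochResponse]
  · intro k _ hk
    simp [stochResponse, hk]
  · simp

theorem stochSubgrad_eq (x : Vec m → Vec n) (l : Vec m) (i : Fin n) :
    S.stochSubgrad x l i = S.b - S.load (stochResponse x l i) := by
  rw [load_stochResponse, stochSubgrad]

theorem stochSubgrad_sub_subgrad (x : Vec m → Vec n) (l : Vec m) (i : Fin n) :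
    S.stochSubgrad x l i - S.subgrad x l = (-1 : ℝ) • S.load (stochResponse x l i - x l) := by
  rw [stochSubgrad_eq, subgrad, sub_eq_add_neg (stochResponse x l i), ← neg_one_smul ℝ (x l),
    load_add, load_smul]
  module

theorem sum_stochSubgrad (hn : 0 < n) (x : Vec m → Vec n) (l : Vec m) :
    ∑ i, (1 / (n : ℝ)) • (S.stochSubgrad x l i - S.subgrad x l) = 0 := by
  have h : ∀ i, (1 / (n : ℝ)) • (S.stochSubgrad x l i - S.subgrad x l)
      = (-1 : ℝ) • S.load ((1 / (n : ℝ)) • (stochResponse x l i - x l)) := fun i => by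
    rw [stochSubgrad_sub_subgrad, smul_comm, load_smul]
  rw [Finset.sum_congr rfl fun i _ => h i, ← Finset.smul_sum, ← load_sum, sum_stochResponse hn]
  simp [load]

end Network

namespace Network

/-! ### Concentration of the noise along the trajectory -/

section Noise

variable {m n : ℕ} {S : Network m n} {x : Vec m → Vec n}
  {Ω : Type*} [MeasurableSpace Ω] {P : Measure Ω} [IsProbabilityMeasure P]
  {ξ : ℕ → Ω → Fin n}

theorem norm_subgrad_le (hn : 0 < n) {M : ℝ} {l : Vec m}
    (hM : ∀ i, ‖S.stochSubgrad x l i‖ ≤ M) : ‖S.subgrad x l‖ ≤ M := by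
  have hn' : (n : ℝ) ≠ 0 := by exact_mod_cast hn.ne'
  have h := sum_stochSubgrad (S := S) hn x l
  simp only [smul_sub, Finset.sum_sub_distrib, sub_eq_zero] at h
  have h1 : ∑ _i : Fin n, (1 / (n : ℝ)) • S.subgrad x l = S.subgrad x l := by
    rw [← Finset.sum_smul]; simp [hn']
  rw [← h1, ← h]
  refine (norm_sum_le _ _).trans ?_
  calc ∑ i, ‖(1 / (n : ℝ)) • S.stochSubgrad x l i‖ ≤ ∑ _i : Fin n, 1 / (n : ℝ) * M := by
        refine Finset.sum_le_sum fun i _ => ?_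
        rw [norm_smul, Real.norm_of_nonneg (by positivity)]
        exact mul_le_mul_of_nonneg_left (hM i) (by positivity)
    _ = M := by rw [← Finset.sum_mul]; simp [hn']

/-- Boundedness makes `2 M` a light-tail parameter, too. -/
theorem sum_exp_stochSubgrad_sub_le (hn : 0 < n) {M σ : ℝ} (hM0 : 0 < M) {l : Vec m}
    (hM : ∀ i, ‖S.stochSubgrad x l i‖ ≤ M)
    (ht : ∑ i, 1 / (n : ℝ) * Real.exp (‖S.stochSubgrad x l i - S.subgrad x l‖ ^ 2 / σ ^ 2)
      ≤ Real.exp 1) :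
    ∑ i, 1 / (n : ℝ)
      * Real.exp (‖S.stochSubgrad x l i - S.subgrad x l‖ ^ 2 / (min σ (2 * M)) ^ 2)
      ≤ Real.exp 1 := by
  rcases min_choice σ (2 * M) with h | h
  · rwa [h]
  · rw [h]
    have hn' : (n : ℝ) ≠ 0 := by exact_mod_cast hn.ne'
    calc _ ≤ ∑ _i : Fin n, 1 / (n : ℝ) * Real.exp 1 := by
          refine Finset.sum_le_sum fun i _ => mul_le_mul_of_nonneg_left ?_ (by positivity)
          rw [Real.exp_le_exp, div_le_one (by positivity)]
          have h1 : ‖S.stochSubgrad x l i - S.subgrad x l‖ ≤ 2 * M :=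
            (norm_sub_le _ _).trans (by linarith [hM i, norm_subgrad_le hn hM])
          gcongr
      _ = Real.exp 1 := by rw [← Finset.sum_mul]; simp [hn']

/-- The size of the noise scales with the uncontrolled price norm. Dual optimality gives the squared
distance to `lstar` a nonpositive drift up to `β²M²`, so adding that distance to the exponent lets
its decreasing weight absorb the variance. -/
theorem measureReal_sum_inner_noise_gt_le
    (hn : 0 < n) (hm : ∀ t, Measurable (ξ t)) (hi : iIndepFun ξ P)
    (hu : ∀ t i, P.real {ω | ξ t ω = i} = 1 / (n : ℝ)) {N : ℕ} (hN : 0 < N)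
    (hx : S.IsResponse x) {lstar : Vec m} (hl : S.IsDualSolution lstar) {R M τ : ℝ}
    (hM0 : 0 < M) (hR : 0 < R) (hlR : ‖lstar‖ ≤ R) (hτ : 0 < τ) (hτM : τ ≤ 2 * M)
    (hM : ∀ l ∈ orthant m, ∀ i, ‖S.stochSubgrad x l i‖ ≤ M)
    (ht : ∀ l ∈ orthant m, ∑ i, 1 / (n : ℝ)
      * Real.exp (‖S.stochSubgrad x l i - S.subgrad x l‖ ^ 2 / τ ^ 2) ≤ Real.exp 1)
    {p : (ℕ → Fin n) → ℕ → Vec m} (hp : p = S.price x (R / (M * √(N : ℝ))))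
    {δ : ℝ} (hδ : 0 < δ) :
    P.real {ω | τ * R * √(N : ℝ) * (3 + 50 * Real.log (1 / δ)) <
      ∑ t ∈ Finset.range N, -inner ℝ
        (S.stochSubgrad x (p (fun r => ξ r ω) t) (ξ t ω) - S.subgrad x (p (fun r => ξ r ω) t))
        (p (fun r => ξ r ω) t)} ≤ δ := by
  have hn' : (0 : ℝ) < n := by exact_mod_cast hn
  have hN' : (0 : ℝ) < N := by exact_mod_cast hN
  set q : ℝ := √(N : ℝ) with hq
  have hq0 : 0 < q := Real.sqrt_pos.mpr hN'
  have hqN : q ^ 2 = N := Real.sq_sqrt hN'.le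
  set β : ℝ := R / (M * q) with hβ
  have hβ0 : 0 < β := by positivity
  set μ : ℝ := 1 / (50 * (R * τ * q)) with hμ
  have hμ0 : 0 < μ := by positivity
  let z : ℕ → (ℕ → Fin n) → Fin n → ℝ := fun t s i =>
    -inner ℝ (S.stochSubgrad x (p s t) i - S.subgrad x (p s t)) (p s t)
  have hpdep : ∀ t, ∀ s s' : ℕ → Fin n, (∀ r < t, s r = s' r) → p s t = p s' t := by
    intro t s s' h
    rw [hp]; exact S.price_congr x _ t s s' h
  have hpo : ∀ s t, p s t ∈ orthant m := by
    intro s t; rw [hp]; exact S.price_mem_orthant x _ s t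
  have hzdep : ∀ t, ∀ s s' : ℕ → Fin n, (∀ r < t, s r = s' r) → z t s = z t s' := by
    intro t s s' h
    simp only [z, hpdep t s s' h]
  -- The potential starts at most at `R²/(50R²) = 1/50` and the compensator ends at `1/25`; together
  -- they give the `3/50` that `1/μ` turns into the constant 3.
  have key := measureReal_supermartingale_gt_le hm hi hu (N := N)
    (Y := fun t s => μ * ∑ r ∈ Finset.range t, z r s (s r)
      + (1 - t / N) / (50 * R ^ 2) * ‖p s t - lstar‖ ^ 2 - t / (25 * N))
    (fun t s s' h => by rw [sum_range_congr_of_dependsOn hzdep h, hpdep t s s' h]) ?_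
    (c := 1 / 50) (fun s => ?_) hδ
  · refine le_trans (measureReal_mono fun ω hω => ?_) key
    simp only [Set.mem_ofPred_eq] at hω ⊢
    set Z := ∑ t ∈ Finset.range N, z t (fun r => ξ r ω) (ξ t ω)
    have h1 : μ * (τ * R * q * (3 + 50 * Real.log (1 / δ))) < μ * Z :=
      mul_lt_mul_of_pos_left hω hμ0
    have h2 : μ * (τ * R * q * (3 + 50 * Real.log (1 / δ)))
        = 3 / 50 + Real.log (1 / δ) := by rw [hμ]; field_simp
    have h3 : (N : ℝ) / N = 1 := div_self hN'.ne'
    have h4 : (N : ℝ) / (25 * N) = 1 / 25 := by field_simp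
    rw [h3, h4]
    rw [h2] at h1
    simp only [sub_self, zero_div, zero_mul, add_zero]
    linarith
  · intro t htN s
    set D := ‖p s t - lstar‖ with hD
    have hD0 : 0 ≤ D := norm_nonneg _
    set θ : ℝ := (1 - (t + 1 : ℕ) / N) / (50 * R ^ 2) with hθ
    have hfrac : ((t + 1 : ℕ) : ℝ) / N ≤ 1 := by
      rw [div_le_one hN']; exact_mod_cast htN
    have hfrac0 : 0 ≤ ((t + 1 : ℕ) : ℝ) / N := by positivity
    have hθ0 : 0 ≤ θ := div_nonneg (by linarith) (by positivity)
    have hθ1 : θ ≤ 1 / (50 * R ^ 2) := by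
      rw [hθ]; gcongr; linarith
    set Z := ∑ r ∈ Finset.range t, z r s (s r) with hZ
    let dd : Fin n → Vec m := fun i => S.stochSubgrad x (p s t) i - S.subgrad x (p s t)
    -- `v` collects everything paired with the noise at this step: the summand itself, with `p = (p
    -- - lstar) + lstar`, and the cross term of the squared distance.
    set v : Vec m := -((μ + 2 * β * θ) • (p s t - lstar) + μ • lstar) with hv
    set B : ℝ := μ * Z + θ * D ^ 2 + θ * (β ^ 2 * M ^ 2) - (t + 1 : ℕ) / (25 * N) with hB
    have hpt : ∀ i, p (Function.update s t i) t = p s t := fun i =>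
      hpdep t _ _ fun r hr => Function.update_of_ne (show r ≠ t by omega) _ _
    have hbound : ∀ i, μ * ∑ r ∈ Finset.range (t + 1),
          z r (Function.update s t i) (Function.update s t i r)
          + θ * ‖p (Function.update s t i) (t + 1) - lstar‖ ^ 2 - (t + 1 : ℕ) / (25 * N)
        ≤ B + inner ℝ (dd i) v := by
      intro i
      have h1 := S.norm_sq_price_succ_sub_le x (β := β) hM (Function.update s t i) t hl.1
      rw [← hp, hpt i, Function.update_self, ← hD] at h1
      have h2 : inner ℝ (S.stochSubgrad x (p s t) i) (p s t - lstar)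
          = inner ℝ (dd i) (p s t - lstar) + inner ℝ (S.subgrad x (p s t)) (p s t - lstar) := by
        rw [← inner_add_left]; simp [dd]
      have h3 : 0 ≤ inner ℝ (S.subgrad x (p s t)) (p s t - lstar) :=
        (sub_nonneg.mpr (hl.2 (hpo s t))).trans (hx.dual_sub_dual_le (hpo s t) hl.1)
      have h4 : ‖p (Function.update s t i) (t + 1) - lstar‖ ^ 2
          ≤ D ^ 2 - 2 * β * inner ℝ (dd i) (p s t - lstar) + β ^ 2 * M ^ 2 := by
        rw [h2] at h1
        have := mul_nonneg hβ0.le h3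
        linarith
      have h5 := mul_le_mul_of_nonneg_left h4 hθ0
      have h6 : inner ℝ (dd i) v = μ * z t s i - θ * (2 * β * inner ℝ (dd i) (p s t - lstar)) := by
        simp only [hv, z, dd, inner_neg_right, inner_add_right, real_inner_smul_right,
          inner_sub_right]
        ring
      rw [sum_range_update hzdep, ← hZ, h6, hB]
      linarith
    have hmgf := sum_weight_exp_inner_le (w := fun _ : Fin n => 1 / (n : ℝ))
      (fun _ => by positivity) (by simp [hn'.ne']) (sum_stochSubgrad hn x (p s t)) hτ
      (ht _ (hpo s t)) v
    calc ∑ i, 1 / (n : ℝ) * Real.exp (μ * ∑ r ∈ Finset.range (t + 1),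
          z r (Function.update s t i) (Function.update s t i r)
          + θ * ‖p (Function.update s t i) (t + 1) - lstar‖ ^ 2 - (t + 1 : ℕ) / (25 * N))
        ≤ ∑ i, 1 / (n : ℝ) * Real.exp (B + inner ℝ (dd i) v) := by
          refine Finset.sum_le_sum fun i _ => mul_le_mul_of_nonneg_left ?_ (by positivity)
          exact Real.exp_le_exp.mpr (hbound i)
      _ = Real.exp B * ∑ i, 1 / (n : ℝ) * Real.exp (inner ℝ (dd i) v) := by
          rw [Finset.mul_sum]
          exact Finset.sum_congr rfl fun i _ => by rw [Real.exp_add]; ring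
      _ ≤ Real.exp B * Real.exp (τ ^ 2 * ‖v‖ ^ 2) :=
          mul_le_mul_of_nonneg_left hmgf (Real.exp_pos _).le
      _ ≤ _ := by
          rw [← Real.exp_add, Real.exp_le_exp]
          have hv1 : ‖v‖ ≤ (μ + 2 * β * θ) * D + μ * R := by
            rw [hv, norm_neg]
            refine (norm_add_le _ _).trans ?_
            rw [norm_smul, norm_smul, Real.norm_of_nonneg (by positivity),
              Real.norm_of_nonneg hμ0.le]
            gcongr
          -- Here `τ ≤ 2M` cancels the `M` in the denominator of the step size.
          have hβθ : τ * (2 * β * θ) ≤ 4 / (50 * (R * q)) := by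
            calc τ * (2 * β * θ) ≤ (2 * M) * (2 * β * (1 / (50 * R ^ 2))) := by gcongr
              _ = 4 / (50 * (R * q)) := by rw [hβ]; field_simp; norm_num
          have hτμ : τ * μ = 1 / (50 * (R * q)) := by rw [hμ]; field_simp
          have hv2 : τ * ‖v‖ ≤ D / (10 * (R * q)) + 1 / (50 * q) := by
            calc τ * ‖v‖ ≤ τ * ((μ + 2 * β * θ) * D + μ * R) := by gcongr
              _ = (τ * μ + τ * (2 * β * θ)) * D + (τ * μ) * R := by ring
              _ ≤ (1 / (50 * (R * q)) + 4 / (50 * (R * q))) * D + 1 / (50 * (R * q)) * R := by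
                  rw [hτμ]; gcongr
              _ = _ := by field_simp; norm_num; ring
          -- The coefficient of `D²` equals the drop of the weight in one step (`hθt`); the
          -- constants fit into `1/(25N)`.
          have hv3 : τ ^ 2 * ‖v‖ ^ 2 ≤ 1 / (50 * R ^ 2 * N) * D ^ 2 + 1 / (1250 * N) := by
            calc τ ^ 2 * ‖v‖ ^ 2 = (τ * ‖v‖) ^ 2 := by ring
              _ ≤ (D / (10 * (R * q)) + 1 / (50 * q)) ^ 2 := by gcongr
              _ ≤ 2 * ((D / (10 * (R * q))) ^ 2 + (1 / (50 * q)) ^ 2) := add_sq_le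
              _ = _ := by rw [← hqN]; field_simp; norm_num; ring
          have hθβ : θ * (β ^ 2 * M ^ 2) ≤ 1 / (50 * (N : ℝ)) := by
            calc θ * (β ^ 2 * M ^ 2) ≤ 1 / (50 * R ^ 2) * (β ^ 2 * M ^ 2) := by gcongr
              _ = 1 / (50 * (N : ℝ)) := by rw [hβ, ← hqN]; field_simp
          have hθt : (1 - (t : ℝ) / N) / (50 * R ^ 2) = θ + 1 / (50 * R ^ 2 * N) := by
            rw [hθ]; push_cast; field_simp; ring
          have hlin : ((t + 1 : ℕ) : ℝ) / (25 * N) = t / (25 * N) + 1 / (25 * N) := by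
            push_cast; rw [add_div]
          have hconst : 1 / (50 * (N : ℝ)) + 1 / (1250 * N) ≤ 1 / (25 * N) := by
            rw [← sub_nonneg]
            have : 1 / (25 * (N : ℝ)) - (1 / (50 * N) + 1 / (1250 * N)) = 24 / (1250 * N) := by
              field_simp; norm_num
            rw [this]; positivity
          rw [hθt, hB, hlin, add_mul]
          linarith
  · have h0 : p s 0 = 0 := by rw [hp]; rfl
    have h1 : ‖lstar‖ ^ 2 ≤ R ^ 2 := by gcongr
    simp only [Finset.range_zero, Finset.sum_empty, h0, zero_sub, norm_neg, Nat.cast_zero,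
      zero_div, mul_zero, sub_zero, zero_add]
    calc 1 / (50 * R ^ 2) * ‖lstar‖ ^ 2 ≤ 1 / (50 * R ^ 2) * R ^ 2 := by gcongr
      _ = 1 / 50 := by field_simp

end Noise

/-! ### The primal-dual gap along a trajectory -/

section Gap

variable {m n : ℕ} {S : Network m n} {x : Vec m → Vec n}

theorem smul_sum_mem_orthant {ι : Type*} (s : Finset ι) {c : ℝ} (hc : 0 ≤ c) {y : ι → Vec n}
    (hy : ∀ i ∈ s, y i ∈ orthant n) : c • ∑ i ∈ s, y i ∈ orthant n := by
  intro k
  simp only [PiLp.smul_apply, WithLp.ofLp_sum, Finset.sum_apply, smul_eq_mul]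
  exact mul_nonneg hc (Finset.sum_nonneg fun i hi => hy i hi k)

theorem IsResponse.stochResponse_mem_orthant (hx : S.IsResponse x) {l : Vec m}
    (hl : l ∈ orthant m) (i : Fin n) : stochResponse x l i ∈ orthant n := by
  intro k
  have := (hx l hl i).1
  by_cases h : k = i
  · subst h; simp [stochResponse]; positivity
  · simp [stochResponse, h]

theorem IsResponse.primalOutput_mem_orthant (hx : S.IsResponse x) (β : ℝ) (s : ℕ → Fin n)
    (N : ℕ) : S.primalOutput x β s N ∈ orthant n :=
  smul_sum_mem_orthant _ (by positivity) fun t _ =>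
    hx.stochResponse_mem_orthant (S.price_mem_orthant x β s t) _

theorem IsResponse.gap_le (hx : S.IsResponse x) {lstar : Vec m} (hl : S.IsDualSolution lstar)
    {MU R M : ℝ} (hM0 : 0 < M) (hR : 0 < R)
    (hU : ∀ y ∈ orthant n, ∀ z ∈ orthant n, |S.utility y - S.utility z| ≤ MU * ‖y - z‖)
    (hM : ∀ l ∈ orthant m, ∀ i, ‖S.stochSubgrad x l i‖ ≤ M) (s : ℕ → Fin n) {N : ℕ}
    (hN : 0 < N) {p : ℕ → Vec m} (hp : p = S.price x (R / (M * √(N : ℝ))) s)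
    {y : Vec n} (hy : y = S.primalOutput x (R / (M * √(N : ℝ))) s N) :
    N * (S.dual lstar - S.utility y + 2 * R * ‖plusPart (S.load y - S.b)‖) ≤
      2.5 * R * M * √(N : ℝ)
        + MU * ‖∑ t ∈ Finset.range N, (stochResponse x (p t) (s t) - x (p t))‖
        + ∑ t ∈ Finset.range N,
            -inner ℝ (S.stochSubgrad x (p t) (s t) - S.subgrad x (p t)) (p t) := by
  have hN' : (0 : ℝ) < N := by exact_mod_cast hN
  set q : ℝ := √(N : ℝ) with hq
  have hq0 : 0 < q := Real.sqrt_pos.mpr hN'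
  have hqN : q ^ 2 = N := Real.sq_sqrt hN'.le
  have hpo : ∀ t, p t ∈ orthant m := fun t => hp ▸ S.price_mem_orthant x _ s t
  -- The comparator may depend on the whole trajectory because the regret bound is pathwise. With
  -- radius `2R`, the regret is at most `2RMq + RMq/2`, whence 2.5.
  obtain ⟨w, hw, hwR, hwv⟩ := exists_mem_orthant_inner_eq (S.load y - S.b)
    (by positivity : 0 ≤ 2 * R)
  have hreg := S.sum_inner_stochSubgrad_le x (β := R / (M * q)) (by positivity) hM s N hw
  rw [← hp] at hreg
  have hrhs : ‖w‖ ^ 2 / (2 * (R / (M * q))) + N * (R / (M * q) * M ^ 2 / 2)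
      ≤ 2.5 * R * M * q := by
    have h1 : ‖w‖ ^ 2 ≤ (2 * R) ^ 2 := by gcongr
    calc ‖w‖ ^ 2 / (2 * (R / (M * q))) + N * (R / (M * q) * M ^ 2 / 2)
        ≤ (2 * R) ^ 2 / (2 * (R / (M * q))) + N * (R / (M * q) * M ^ 2 / 2) := by gcongr
      _ = 2.5 * R * M * q := by rw [← hqN]; field_simp; norm_num
  have hybar : (N : ℝ) • y = ∑ t ∈ Finset.range N, stochResponse x (p t) (s t) := by
    rw [hy, primalOutput, smul_smul, mul_one_div_cancel hN'.ne', one_smul, hp]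
  -- Against `w` the stochastic subgradients sum exactly to `N(b - Cy)`, so this random comparator
  -- creates no noise term.
  have hw2 : ∑ t ∈ Finset.range N, inner ℝ (S.stochSubgrad x (p t) (s t)) w
      = -(N * (2 * R * ‖plusPart (S.load y - S.b)‖)) := by
    rw [← hwv, ← sum_inner]
    simp_rw [stochSubgrad_eq]
    rw [Finset.sum_sub_distrib, ← S.load_sum, ← hybar, load_smul, Finset.sum_const,
      Finset.card_range, ← Nat.cast_smul_eq_nsmul ℝ, ← smul_sub, real_inner_smul_left,
      ← neg_sub (S.load y), inner_neg_left]
    ring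
  have hterm : ∀ t, inner ℝ (S.stochSubgrad x (p t) (s t)) (p t - w)
      = inner ℝ (S.stochSubgrad x (p t) (s t) - S.subgrad x (p t)) (p t)
        + (S.dual (p t) - S.utility (x (p t)))
        - inner ℝ (S.stochSubgrad x (p t) (s t)) w := by
    intro t
    rw [← hx.inner_subgrad_self (hpo t), inner_sub_right, inner_sub_left]
    ring
  simp only [hterm, Finset.sum_sub_distrib, Finset.sum_add_distrib, hw2] at hreg
  have hdual : N * S.dual lstar ≤ ∑ t ∈ Finset.range N, S.dual (p t) := by
    have := Finset.card_nsmul_le_sum (Finset.range N) (fun t => S.dual (p t)) (S.dual lstar)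
      fun t _ => hl.2 (hpo t)
    simpa using this
  set xbar : Vec n := (1 / (N : ℝ)) • ∑ t ∈ Finset.range N, x (p t) with hxbar
  have hconc : ∑ t ∈ Finset.range N, S.utility (x (p t)) ≤ N * S.utility xbar := by
    have h := S.concaveOn_utility.le_map_sum (t := Finset.range N)
      (w := fun _ => 1 / (N : ℝ)) (p := fun t => x (p t)) (fun _ _ => by positivity)
      (by simp [hN'.ne']) fun t _ => hx.mem_orthant (hpo t)
    rw [← Finset.smul_sum, ← Finset.smul_sum, smul_eq_mul] at h
    have h2 := mul_le_mul_of_nonneg_left h hN'.le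
    rwa [← mul_assoc, mul_one_div_cancel hN'.ne', one_mul] at h2
  have hyo : y ∈ orthant n := hy ▸ hx.primalOutput_mem_orthant _ s N
  have hxo : xbar ∈ orthant n :=
    smul_sum_mem_orthant _ (by positivity) fun t _ => hx.mem_orthant (hpo t)
  have hlip := le_of_abs_le (hU xbar hxo y hyo)
  have hdiff : N * ‖xbar - y‖
      = ‖∑ t ∈ Finset.range N, (stochResponse x (p t) (s t) - x (p t))‖ := by
    rw [Finset.sum_sub_distrib, ← hybar, norm_sub_rev xbar y]
    have : ∑ t ∈ Finset.range N, x (p t) = (N : ℝ) • xbar := by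
      rw [hxbar, smul_smul, mul_one_div_cancel hN'.ne', one_smul]
    rw [this, ← smul_sub, norm_smul, Real.norm_of_nonneg hN'.le]
  have hlipN := mul_le_mul_of_nonneg_left hlip hN'.le
  rw [← hdiff, Finset.sum_neg_distrib]
  linarith

/-- The Lagrangian bound at `lstar` shows that the gap is at least `-R` times the violation; of the
`2R` in `h`, one `R` offsets this and the other bounds the violation. -/
theorem IsResponse.utility_sub_le_and_norm_le (hx : S.IsResponse x) {lstar : Vec m}
    (hl : S.IsDualSolution lstar) {xstar : Vec n} (hs : S.IsPrimalSolution xstar) {R ε : ℝ}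
    (hR : 0 < R) (hlR : ‖lstar‖ ≤ R) {y : Vec n} (hy : y ∈ orthant n)
    (h : S.dual lstar - S.utility y + 2 * R * ‖plusPart (S.load y - S.b)‖ ≤ ε) :
    S.utility xstar - S.utility y ≤ ε ∧ ‖plusPart (S.load y - S.b)‖ ≤ ε / R := by
  have h0 := norm_nonneg (plusPart (S.load y - S.b))
  have h1 := hs.utility_le_dual hx hl.1
  have h2 := hx.lagrangian_le_dual hl.1 hy
  have h3 := inner_le_norm_mul_norm_plusPart hl.1 (S.load y - S.b)
  have h4 : ‖lstar‖ * ‖plusPart (S.load y - S.b)‖ ≤ R * ‖plusPart (S.load y - S.b)‖ := by gcongr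
  rw [lagrangian, ← neg_sub (S.load y), inner_neg_right] at h2
  constructor
  · nlinarith
  · rw [le_div_iff₀ hR]
    linarith

end Gap

end Network

/-! ### The iteration count -/

theorem noise_term_le {M σ R ε δ A q : ℝ} (hM : 0 < M) (hσ : 0 < σ) (hR : 0 < R) (hε : 0 < ε)
    (hδ : 0 < δ) (hδ1 : δ < 1) (hA : √(3 * Real.log (1 / δ)) * (2 * R * σ) ≤ A)
    (hAL : 300 ^ 2 * (A ^ 2 * max 1 (Real.log (M * R / (ε * δ)))) ≤ (ε * q) ^ 2)
    (hq300 : 300 ≤ q) :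
    50 * (min σ (2 * M) * R * Real.log (1 / δ)) ≤ 250 / 300 * (ε * q) := by
  set ℓ := Real.log (1 / δ) with hℓ
  set L := max 1 (Real.log (M * R / (ε * δ))) with hL
  have hℓ0 : 0 < ℓ := Real.log_pos (by rw [lt_div_iff₀ hδ]; linarith)
  have hL1 : 1 ≤ L := le_max_left _ _
  have hq0 : 0 < q := by linarith
  set r := √(3 * ℓ) with hr
  have hr0 : 0 ≤ r := Real.sqrt_nonneg _
  have hr2 : r ^ 2 = 3 * ℓ := Real.sq_sqrt (by positivity)
  set τ := min σ (2 * M) with hτ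
  have hτσ : τ ≤ σ := min_le_left _ _
  have hτM : τ ≤ 2 * M := min_le_right _ _
  -- If `ℓ ≤ 2L`, then `ℓ² ≤ 2ℓL` and `A²L` dominates `(σRℓ)²`. Otherwise `L ≥ ℓ - ln(ε/(MR))`
  -- forces `ℓ ≤ 2ε/(MR)`, and `τ ≤ 2M` makes the term at most `200ε`.
  rcases le_total ℓ (2 * L) with h | h
  · have h1 : σ * R * ℓ ≤ ε * q / 300 := by
      refine le_of_sq_le_sq ?_ (by positivity)
      have h3 : (r * (2 * R * σ)) ^ 2 * L ≤ A ^ 2 * L := by gcongr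
      have h4 : (r * (2 * R * σ)) ^ 2 * L = 6 * ((σ * R) ^ 2 * ℓ) * (2 * L) := by
        rw [mul_pow, hr2]; ring
      have h5 : 6 * ((σ * R) ^ 2 * ℓ) * ℓ ≤ 6 * ((σ * R) ^ 2 * ℓ) * (2 * L) := by gcongr
      have h6 : 0 ≤ (σ * R * ℓ) ^ 2 := sq_nonneg _
      rw [div_pow, le_div_iff₀ (by norm_num)]
      nlinarith
    have h7 : τ * R * ℓ ≤ σ * R * ℓ := by gcongr
    have h8 : 0 < ε * q := by positivity
    linarith
  · have h1 : Real.log (M * R / (ε * δ)) ≤ L := le_max_right _ _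
    have h2 : Real.log (M * R / (ε * δ)) = ℓ - Real.log (ε / (M * R)) := by
      rw [hℓ, ← Real.log_div (by positivity) (by positivity)]
      congr 1
      field_simp
    have h3 : Real.log (ε / (M * R)) ≤ ε / (M * R) :=
      (Real.log_le_sub_one_of_pos (by positivity)).trans (by linarith)
    have h4 : ℓ ≤ 2 * (ε / (M * R)) := by linarith
    calc 50 * (τ * R * ℓ) ≤ 50 * (2 * M * R * (2 * (ε / (M * R)))) := by gcongr
      _ = 200 * ε := by field_simp; norm_num
      _ ≤ 250 / 300 * (ε * q) := by nlinarith

theorem error_le_of_iterations {MU M σ σx R ε δ lmax X Z : ℝ} {N : ℕ}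
    (hMU : 0 ≤ MU) (hM : 0 < M) (hσ : 0 < σ) (hσx : 0 < σx) (hR : 0 < R) (hε : 0 < ε)
    (hδ : 0 < δ) (hδ1 : δ < 1)
    (hN : 90000 * (⌈complexityConst δ MU σx R σ M lmax ^ 2 / ε ^ 2
      * max 1 (Real.log (M * R / (ε * δ)))⌉₊ : ℝ) ≤ N)
    (hX : X ^ 2 ≤ σx ^ 2 * N * (2 + 32 * Real.log (1 / δ)))
    (hZ : Z ≤ min σ (2 * M) * R * √(N : ℝ) * (3 + 50 * Real.log (1 / δ))) :
    0 < N ∧ 2.5 * R * M * √(N : ℝ) + MU * X + Z ≤ N * ε := by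
  set A := complexityConst δ MU σx R σ M lmax with hA
  set L := max 1 (Real.log (M * R / (ε * δ))) with hL
  set ℓ := Real.log (1 / δ) with hℓ
  have hℓ0 : 0 < ℓ := Real.log_pos (by rw [lt_div_iff₀ hδ]; linarith)
  have hL1 : 1 ≤ L := le_max_left _ _
  have hlm : 0 ≤ √lmax := Real.sqrt_nonneg _
  set r := √(3 * ℓ) with hr
  have hr0 : 0 ≤ r := Real.sqrt_nonneg _
  have hr2 : r ^ 2 = 3 * ℓ := Real.sq_sqrt (by positivity)
  set c := √2 * (1 + r) with hc
  have hc0 : 0 ≤ c := by positivity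
  have hc2 : c ^ 2 = 2 * (1 + r) ^ 2 := by
    rw [hc, mul_pow, Real.sq_sqrt (by norm_num)]
  have hAeq : A = c * (MU * σx) + c * (2 * R * σ) + c * (2 * R * (σx * √lmax)) + 2.5 * R * M := by
    rw [hA, complexityConst, ← hℓ, ← hr, ← hc]; ring
  have hA1 : 0 ≤ c * (MU * σx) := by positivity
  have hA2 : 0 ≤ c * (2 * R * σ) := by positivity
  have hA3 : 0 ≤ c * (2 * R * (σx * √lmax)) := by positivity
  have hA4 : 0 < 2.5 * R * M := by positivity
  have hA0 : 0 < A := by linarith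
  have hceil : A ^ 2 / ε ^ 2 * L ≤ (⌈A ^ 2 / ε ^ 2 * L⌉₊ : ℝ) := Nat.le_ceil _
  have hceil1 : (1 : ℝ) ≤ (⌈A ^ 2 / ε ^ 2 * L⌉₊ : ℝ) := by
    exact_mod_cast Nat.ceil_pos.mpr (by positivity)
  have hN9 : (90000 : ℝ) ≤ N := by linarith
  have hN0 : (0 : ℝ) < N := by linarith
  refine ⟨by exact_mod_cast hN0, ?_⟩
  set q := √(N : ℝ) with hq
  have hq0 : 0 < q := Real.sqrt_pos.mpr hN0
  have hqN : q ^ 2 = N := Real.sq_sqrt hN0.le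
  have hq300 : 300 ≤ q := by
    rw [hq]; exact Real.le_sqrt_of_sq_le (by linarith)
  have hAL : 300 ^ 2 * (A ^ 2 * L) ≤ (ε * q) ^ 2 := by
    have h : 90000 * (A ^ 2 / ε ^ 2 * L) ≤ q ^ 2 := by rw [hqN]; linarith
    have h2 := mul_le_mul_of_nonneg_left h (sq_nonneg ε)
    have h3 : ε ^ 2 * (90000 * (A ^ 2 / ε ^ 2 * L)) = 300 ^ 2 * (A ^ 2 * L) := by
      field_simp; norm_num
    rw [mul_pow]; linarith
  have hbase : 300 * A ≤ ε * q := by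
    refine le_of_sq_le_sq ?_ (by positivity)
    have : A ^ 2 * 1 ≤ A ^ 2 * L := by gcongr
    rw [mul_pow]; linarith
  have hc1 : 1 ≤ c := by
    have : (1 : ℝ) ≤ √2 := Real.one_le_sqrt.mpr (by norm_num)
    rw [hc]; exact one_le_mul_of_one_le_of_one_le this (by linarith)
  have hXc : X ≤ 4 * c * σx * q := by
    refine le_of_sq_le_sq (hX.trans ?_) (by positivity)
    have h1 : (4 * c * σx * q) ^ 2 = σx ^ 2 * N * (32 * (1 + r) ^ 2) := by
      rw [← hqN, mul_pow, mul_pow, mul_pow, hc2]; ring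
    rw [h1]
    gcongr
    have h2 : 32 * (1 + r) ^ 2 = 32 + 64 * r + 32 * r ^ 2 := by ring
    rw [h2, hr2]
    linarith
  have hMUX : MU * X ≤ 4 * A * q := by
    calc MU * X ≤ MU * (4 * c * σx * q) := by gcongr
      _ = 4 * (c * (MU * σx)) * q := by ring
      _ ≤ 4 * A * q := by gcongr; linarith
  set τ := min σ (2 * M) with hτ
  have hτσ : τ ≤ σ := min_le_left _ _
  have hτM : τ ≤ 2 * M := min_le_right _ _
  have h3τ : 3 * (τ * R) ≤ 3 * A := by
    have h1 : τ * R ≤ σ * R := by gcongr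
    have h2 : 1 * (2 * R * σ) ≤ c * (2 * R * σ) := by gcongr
    have h3 : 0 < R * σ := by positivity
    linarith
  have hrc : r ≤ c := by
    have h1 : (1 : ℝ) ≤ √2 := Real.one_le_sqrt.mpr (by norm_num)
    have h2 : 1 * (1 + r) ≤ √2 * (1 + r) := by gcongr
    rw [hc]; linarith
  have hrA : r * (2 * R * σ) ≤ A := by
    have : r * (2 * R * σ) ≤ c * (2 * R * σ) := by gcongr
    linarith
  have hmain : 50 * (τ * R * ℓ) ≤ 250 / 300 * (ε * q) :=
    noise_term_le hM hσ hR hε hδ hδ1 hrA hAL hq300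
  have hZ2 : Z ≤ (3 * (τ * R) + 50 * (τ * R * ℓ)) * q := by
    calc Z ≤ _ := hZ
      _ = _ := by ring
  -- The budget: `A ≤ εq/300` makes the total at most `(8 + 250)/300` of `εq²`.
  calc 2.5 * R * M * q + MU * X + Z
      ≤ A * q + 4 * A * q + (3 * A + 250 / 300 * (ε * q)) * q := by
        have h1 : 2.5 * R * M * q ≤ A * q := by gcongr; linarith
        have h2 : (3 * (τ * R) + 50 * (τ * R * ℓ)) * q ≤ (3 * A + 250 / 300 * (ε * q)) * q := by
          gcongr
        linarith
    _ = (8 * A + 250 / 300 * (ε * q)) * q := by ring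
    _ ≤ (ε * q) * q := by
        gcongr
        have : 0 < ε * q := by positivity
        linarith
    _ = N * ε := by rw [← hqN]; ring

end NetworkUtility

/-! ### Assembly of the theorem -/

theorem mainTheorem2 :
    ∃ K : ℝ, 0 < K ∧
      ∀ (m n : ℕ) (S : Network m n) (x : Vec m → Vec n) (MU M σ σx R ε δ : ℝ)
        (xstar : Vec n) (lstar : Vec m)
        (Ω : Type*) [MeasurableSpace Ω] (P : Measure Ω) [IsProbabilityMeasure P]
        (ξ : ℕ → Ω → Fin n) (N : ℕ),
        0 < M → 0 < σ → 0 < σx → 0 < R → 0 < ε → 0 < δ → δ < 1 →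
        -- the users drawn are independent and uniformly distributed
        (∀ t, Measurable (ξ t)) → iIndepFun ξ P →
        (∀ t i, P.real {ω | ξ t ω = i} = 1 / (n : ℝ)) →
        -- optimal responses, primal and dual solutions
        S.IsResponse x → S.IsPrimalSolution xstar →
        S.IsDualSolution lstar → ‖lstar‖ ≤ R →
        -- the total utility is Lipschitz
        (∀ y ∈ orthant n, ∀ z ∈ orthant n, |S.utility y - S.utility z| ≤ MU * ‖y - z‖) →
        -- bounded stochastic subgradients
        (∀ l ∈ orthant m, ∀ i, ‖S.stochSubgrad x l i‖ ≤ M) →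
        -- light tails
        (∀ l ∈ orthant m, ∀ t,
          ∫ ω, Real.exp (‖S.stochSubgrad x l (ξ t ω) - S.subgrad x l‖ ^ 2 / σ ^ 2) ∂P
            ≤ Real.exp 1) →
        (∀ l ∈ orthant m, ∀ t,
          ∫ ω, Real.exp (‖stochResponse x l (ξ t ω) - x l‖ ^ 2 / σx ^ 2) ∂P ≤ Real.exp 1) →
        -- the number of iterations
        K * (⌈complexityConst δ MU σx R σ M (lambdaMax S.C) ^ 2 / ε ^ 2
            * max 1 (Real.log (M * R / (ε * δ)))⌉₊ : ℝ) ≤ (N : ℝ) →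
        1 - 4 * δ ≤ P.real {ω |
          S.utility xstar
              - S.utility (S.primalOutput x (R / (M * √(N : ℝ))) (fun t => ξ t ω) N) ≤ ε ∧
          ‖plusPart (S.load (S.primalOutput x (R / (M * √(N : ℝ))) (fun t => ξ t ω) N) - S.b)‖
              ≤ ε / R} := by
  -- `90000 = 300²`, so that `√N` exceeds `A/ε` by the factor 300 of the error budget.
  refine ⟨90000, by norm_num, ?_⟩
  intro m n S x MU M σ σx R ε δ xstar lstar Ω _ P _ ξ N hM0 hσ hσx hR hε hδ hδ1 hm hi hu hx hs
    hl hlR hU hM ht htx hN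
  obtain ⟨ω₀⟩ := nonempty_of_isProbabilityMeasure P
  have hn : 0 < n := Fin.pos (ξ 0 ω₀)
  -- The Lipschitz bound between a unit coordinate vector and `0` forces the sign.
  have hMU : 0 ≤ MU := by
    have h := hU (EuclideanSpace.single ⟨0, hn⟩ 1)
      (fun k => by
        by_cases hk : k = ⟨0, hn⟩
        · simp [hk]
        · simp [hk]) 0 (fun k => le_rfl)
    simpa using (abs_nonneg _).trans h
  have ht' : ∀ l ∈ orthant m, ∑ i, 1 / (n : ℝ)
      * Real.exp (‖S.stochSubgrad x l i - S.subgrad x l‖ ^ 2 / (min σ (2 * M)) ^ 2)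
      ≤ Real.exp 1 := by
    intro l hlo
    refine Network.sum_exp_stochSubgrad_sub_le hn hM0 (hM l hlo) ?_
    have h := ht l hlo 0
    rwa [integral_uniform hm hu 0
      fun i => Real.exp (‖S.stochSubgrad x l i - S.subgrad x l‖ ^ 2 / σ ^ 2)] at h
  have htx' : ∀ l ∈ orthant m, ∑ i, 1 / (n : ℝ)
      * Real.exp (‖stochResponse x l i - x l‖ ^ 2 / σx ^ 2) ≤ Real.exp 1 := by
    intro l hlo
    have h := htx l hlo 0
    rwa [integral_uniform hm hu 0
      fun i => Real.exp (‖stochResponse x l i - x l‖ ^ 2 / σx ^ 2)] at h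
  have hNpos : 0 < N := (error_le_of_iterations (X := 0) (Z := 0) hMU hM0 hσ hσx hR hε hδ hδ1 hN
    (by
      have : 0 < Real.log (1 / δ) := Real.log_pos (by rw [lt_div_iff₀ hδ]; linarith)
      rw [zero_pow two_ne_zero]
      positivity)
    (by
      have : 0 < Real.log (1 / δ) := Real.log_pos (by rw [lt_div_iff₀ hδ]; linarith)
      have : 0 < min σ (2 * M) := by positivity
      positivity)).1
  set β := R / (M * √(N : ℝ)) with hβ
  set p := S.price x β with hp
  have hdevx := measureReal_norm_sq_sum_gt_le hn hm hi hu hNpos hσx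
    (d := fun t s i => stochResponse x (p s t) i - x (p s t))
    (fun t s s' h => by simp only [hp, S.price_congr x β t s s' h])
    (fun t s => Network.sum_stochResponse hn x _)
    (fun t s => htx' _ (S.price_mem_orthant x β s t)) hδ
  have hdev := Network.measureReal_sum_inner_noise_gt_le hn hm hi hu hNpos hx hl hM0 hR hlR
    (τ := min σ (2 * M)) (by positivity) (min_le_right _ _) hM ht' hp hδ
  set B₁ := {ω | σx ^ 2 * N * (2 + 32 * Real.log (1 / δ)) <
    ‖∑ t ∈ Finset.range N, (stochResponse x (p (fun r => ξ r ω) t) (ξ t ω)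
      - x (p (fun r => ξ r ω) t))‖ ^ 2} with hB₁
  set B₂ := {ω | min σ (2 * M) * R * √(N : ℝ) * (3 + 50 * Real.log (1 / δ)) <
    ∑ t ∈ Finset.range N, -inner ℝ
      (S.stochSubgrad x (p (fun r => ξ r ω) t) (ξ t ω) - S.subgrad x (p (fun r => ξ r ω) t))
      (p (fun r => ξ r ω) t)} with hB₂
  set G := {ω | S.utility xstar - S.utility (S.primalOutput x β (fun t => ξ t ω) N) ≤ ε ∧
    ‖plusPart (S.load (S.primalOutput x β (fun t => ξ t ω) N) - S.b)‖ ≤ ε / R} with hG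
  -- Off the two bad events the argument is deterministic; the union bound then leaves probability
  -- at least `1 - 2δ`.
  have hcover : Set.univ ⊆ G ∪ (B₁ ∪ B₂) := by
    intro ω _
    by_contra hω
    simp only [Set.mem_union, not_or] at hω
    obtain ⟨hωG, hω1, hω2⟩ := hω
    apply hωG
    simp only [hB₁, hB₂, Set.mem_ofPred_eq, not_lt] at hω1 hω2
    have herr := (error_le_of_iterations hMU hM0 hσ hσx hR hε hδ hδ1 hN hω1 hω2).2
    have hgap := hx.gap_le hl hM0 hR hU hM (fun t => ξ t ω) hNpos
      (p := p fun t => ξ t ω) rfl rfl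
    have hN' : (0 : ℝ) < N := by exact_mod_cast hNpos
    exact hx.utility_sub_le_and_norm_le hl hs hR hlR (hx.primalOutput_mem_orthant β _ N)
      (le_of_mul_le_mul_left (hgap.trans herr) hN')
  have h1 : (1 : ℝ) ≤ P.real G + (P.real B₁ + P.real B₂) :=
    calc (1 : ℝ) = P.real Set.univ := by simp
      _ ≤ P.real (G ∪ (B₁ ∪ B₂)) := measureReal_mono hcover
      _ ≤ P.real G + P.real (B₁ ∪ B₂) := measureReal_union_le _ _
      _ ≤ _ := by gcongr; exact measureReal_union_le _ _
  linarith
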